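/- Let $G=(V,E)$ be a finite (simple) graph and let $k\ge 1$ be an integer. Recall that a graph is $\ell$-connected if it has more than $\ell$ vertices and deleting any set of fewer than $\ell$ vertices leaves a connected graph. A *$k$-block* of $G$ is a maximal set $X$ of at least $k$ vertices such that no two vertices $x,x'\in X$ can be separated in $G$ by fewer than $k$ vertices other than $x$ and $x'$. A *tree-decomposition* of $G$ is a pair $(T,(V_t)_{t\in T})$ of a tree $T$ and a family of sets $V_t\subseteq V$ (its *parts*) indexed by the nodes of $T$, such that $V=\bigcup_t V_t$, every edge of $G$ has both its ends in some $V_t$, and $V_r\cap V_t\subseteq V_s$ whenever $s$ lies on the path in $T$ between $r$ and $t$. It has *adhesion $<k$* if $|V_s\cap V_t|<k$ for every edge $st$ of $T$. It is *canonical* if the automorphism group of $G$ acts on $T$ by automorphisms so that $V_{\sigma t}=\sigma(V_t)$ for every automorphism $\sigma$ of $G$ and every node $t$ of $T$. **Theorem 3.4.** Assume that $G$ is $(k-1)$-connected, and that every pair $x,y$ of adjacent vertices has at least one of the following properties: (i) $x$ and $y$ have at least $k-3$ common neighbours; (ii) $x$ and $y$ are joined by at least $\lfloor \tfrac32(k-2)\rfloor$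 independent paths (paths that pairwise meet only in $x$ and $y$) other than the edge $xy$; (iii) $x$ and $y$ lie in a common $k$-block. Then $G$ has a canonical tree-decomposition, with a finite tree $T$, of adhesion $<k$ such that every part containing a $k$-block is a $k$-block. In particular, every $k$-block of $G$ is contained in a part, and distinct $k$-blocks are contained in different parts. -/

import Mathlib

universe u v

namespace CanonicalTD

/-- `G` is `k`-connected: it has more than `k` vertices, and deleting fewer than `k` vertices never
disconnects it. -/
def IsKConnected {V : Type u} (G : SimpleGraph V) (k : ℕ) : Prop :=
  k < Nat.card V ∧ ∀ S : Set V, S.ncard < k → (G.induce Sᶜ).Connected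

/-- No two vertices of `X` can be separated in `G` by fewer than `k` vertices other than these
two vertices. -/
def IsInseparable {V : Type u} (G : SimpleGraph V) (k : ℕ) (X : Set V) : Prop :=
  ∀ x ∈ X, ∀ y ∈ X, ∀ S : Set V, S.ncard < k →
    ∀ (hx : x ∈ Sᶜ) (hy : y ∈ Sᶜ), (G.induce Sᶜ).Reachable ⟨x, hx⟩ ⟨y, hy⟩

/-- A `k`-block: a maximal set of at least `k` vertices no two of which can be separated by fewer
than `k` other vertices. -/
def IsKBlock {V : Type u} (G : SimpleGraph V) (k : ℕ) (X : Set V) : Prop :=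
  Maximal (fun Y : Set V => k ≤ Y.ncard ∧ IsInseparable G k Y) X

/-- A set of `x`-`y` paths is independent if distinct members meet only in `x` and `y`. -/
def IndependentPaths {V : Type u} {G : SimpleGraph V} {x y : V} (W : Set (G.Path x y)) : Prop :=
  W.Pairwise fun p q => ∀ w, w ∈ p.1.support → w ∈ q.1.support → w = x ∨ w = y

/-- A tree-decomposition `(T, (V_t))` of `G`, with decomposition tree `T` on the node set `ι` and
parts `V_t = part t`. -/
structure TreeDecomposition {V : Type u} (G : SimpleGraph V) (ι : Type v) where
  tree : SimpleGraph ι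
  isTree : tree.IsTree
  part : ι → Set V
  exists_mem_part : ∀ x : V, ∃ t, x ∈ part t
  exists_adj_mem_part : ∀ x y : V, G.Adj x y → ∃ t, x ∈ part t ∧ y ∈ part t
  inter_subset : ∀ (r t : ι) (p : tree.Path r t), ∀ s ∈ p.1.support, part r ∩ part t ⊆ part s

/-- The adhesion sets `V_s ∩ V_t`, for edges `st` of the decomposition tree, all have fewer than `k`
elements. -/
def TreeDecomposition.AdhesionLT {V : Type u} {G : SimpleGraph V} {ι : Type v}
    (D : TreeDecomposition G ι) (k : ℕ) : Prop :=
  ∀ s t : ι, D.tree.Adj s t → (D.part s ∩ D.part t).ncard < k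

/-- The decomposition is canonical: the automorphisms of `G` act on the decomposition tree by
automorphisms, compatibly with their action on the parts. -/
def TreeDecomposition.IsCanonical {V : Type u} {G : SimpleGraph V} {ι : Type v}
    (D : TreeDecomposition G ι) : Prop :=
  ∃ φ : (G ≃g G) →* (D.tree ≃g D.tree),
    ∀ (σ : G ≃g G) (t : ι), D.part (φ σ t) = σ '' D.part t

end CanonicalTD

/-! For each `k`-block X, consider the minimal separations of order below `k` that have X on the
left and a vertex strictly on the right. Together with their inverses they form an
automorphism-invariant set, `blockSystem`.

This set is nested (`nested_of_minimal`). Let s be minimal for X and let t be proper of order below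
k, with X on its left, say. The corner of s and t containing X and the opposite corner have orders
summing to at most 2(k-1). If the opposite one has order at least k-1, the corner at X has order
below k, and minimality gives s ≤ t. Otherwise (k-1)-connectedness empties the interior of the
opposite corner, and the condition on adjacent vertices forces s⁻¹ ≤ t (`inv_le_of_ncard_lt`).

A nested system yields a tree whose nodes are its consistent orientations and whose edges reverse
one separation; a part is the intersection of the sides pointed to (`treeDecomposition`). No choices
enter, so the result is canonical. A part containing X equals X, because minimal separations for X
cut off every other vertex (`IsKBlock.eq_part`). -/

namespace CanonicalTD

open SimpleGraph

/-- A separation of `G`: two sides covering the vertex set, with no edge between the vertices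
outside the right side and those outside the left side. -/
@[ext]
structure Separation {V : Type u} (G : SimpleGraph V) where
  left : Set V
  right : Set V
  mem_or_mem : ∀ x, x ∈ left ∨ x ∈ right
  not_adj : ∀ x y, x ∉ right → y ∉ left → ¬ G.Adj x y

/-! ### Separations, their corners and orders, and the automorphism action. -/

namespace Separation

variable {V : Type u} {G : SimpleGraph V}

instance : PartialOrder (Separation G) where
  le s t := s.left ⊆ t.left ∧ t.right ⊆ s.right
  le_refl s := ⟨subset_rfl, subset_rfl⟩
  le_trans _ _ _ h h' := ⟨h.1.trans h'.1, h'.2.trans h.2⟩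
  le_antisymm _ _ h h' := Separation.ext (h.1.antisymm h'.1) (h'.2.antisymm h.2)

instance : InvolutiveInv (Separation G) where
  inv s := ⟨s.right, s.left, fun x => (s.mem_or_mem x).symm,
    fun x y hx hy h => s.not_adj y x hy hx h.symm⟩
  inv_inv _ := rfl

@[simp] theorem inv_left (s : Separation G) : s⁻¹.left = s.right := rfl

@[simp] theorem inv_right (s : Separation G) : s⁻¹.right = s.left := rfl

theorem inv_le_inv {s t : Separation G} (h : s ≤ t) : t⁻¹ ≤ s⁻¹ := ⟨h.2, h.1⟩

theorem inv_le_comm {s t : Separation G} (h : s⁻¹ ≤ t) : t⁻¹ ≤ s := ⟨h.2, h.1⟩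

instance [Finite V] : Finite (Separation G) :=
  Finite.of_injective (fun s : Separation G => (s.left, s.right)) fun _ _ h =>
    Separation.ext (congrArg Prod.fst h) (congrArg Prod.snd h)

/-- The vertices common to the two sides. -/
def separator (s : Separation G) : Set V := s.left ∩ s.right

@[simp] theorem separator_inv (s : Separation G) : s⁻¹.separator = s.separator :=
  Set.inter_comm _ _

/-- The corner separation with left side `s.left ∩ t.left`. -/
def inf (s t : Separation G) : Separation G where
  left := s.left ∩ t.left
  right := s.right ∪ t.right
  mem_or_mem x := by
    have := s.mem_or_mem x
    have := t.mem_or_mem x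
    simp only [Set.mem_inter_iff, Set.mem_union]
    tauto
  not_adj x y hx hy h := by
    simp only [Set.mem_union, not_or] at hx
    by_cases hs : y ∈ s.left
    · exact t.not_adj x y hx.2 (fun ht => hy ⟨hs, ht⟩) h
    · exact s.not_adj x y hx.1 hs h

theorem inf_le_left (s t : Separation G) : s.inf t ≤ s :=
  ⟨Set.inter_subset_left, Set.subset_union_left⟩

theorem inf_le_right (s t : Separation G) : s.inf t ≤ t :=
  ⟨Set.inter_subset_right, Set.subset_union_right⟩

/-- The two corner separators have the same union and the same intersection as the separators of `s`
and `t`. -/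
theorem ncard_separator_inf_add [Finite V] (s t : Separation G) :
    (s.inf t).separator.ncard + (s⁻¹.inf t⁻¹).separator.ncard =
      s.separator.ncard + t.separator.ncard := by
  rw [← Set.ncard_union_add_ncard_inter, ← Set.ncard_union_add_ncard_inter s.separator]
  congr 2 <;> ext x <;> have := s.mem_or_mem x <;> have := t.mem_or_mem x <;>
    simp only [separator, inf, inv_left, inv_right, Set.mem_inter_iff, Set.mem_union] <;> tauto

/-- The neighbours of a vertex outside the right side lie in the left side. -/
theorem mem_left_of_adj (s : Separation G) {x y : V} (hx : x ∉ s.right) (h : G.Adj x y) :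
    y ∈ s.left := by
  by_contra hy
  exact s.not_adj x y hx hy h

theorem mem_right_of_adj (s : Separation G) {x y : V} (hx : x ∉ s.left) (h : G.Adj x y) :
    y ∈ s.right :=
  s⁻¹.mem_left_of_adj hx h

theorem mem_left_of_reachable (s : Separation G) {x y : V} (hx : x ∈ s.separatorᶜ)
    (hy : y ∈ s.separatorᶜ) (hxl : x ∈ s.left)
    (h : (G.induce s.separatorᶜ).Reachable ⟨x, hx⟩ ⟨y, hy⟩) : y ∈ s.left := by
  obtain ⟨p⟩ := h
  by_contra hyl
  obtain ⟨d, -, h1, h2⟩ := p.exists_boundary_dart {v | v.1 ∈ s.left} hxl hyl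
  exact s.not_adj d.fst.1 d.snd.1 (fun h => d.fst.2 ⟨h1, h⟩) h2 d.adj

/-- Both sides of the separation have vertices outside the separator. -/
def IsProper (s : Separation G) : Prop := (∃ x, x ∉ s.left) ∧ ∃ x, x ∉ s.right

theorem IsProper.inv {s : Separation G} (h : s.IsProper) : s⁻¹.IsProper := ⟨h.2, h.1⟩

theorem IsProper.le_ncard_separator {s : Separation G} (h : s.IsProper) {l : ℕ}
    (hG : IsKConnected G l) : l ≤ s.separator.ncard := by
  obtain ⟨⟨x, hx⟩, y, hy⟩ := h
  by_contra! hlt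
  exact hx <| s.mem_left_of_reachable (fun h => hy h.2) (fun h => hx h.1)
    ((s.mem_or_mem y).resolve_right hy) ((hG.2 _ hlt).preconnected _ _)

/-- Otherwise `x` could be dropped from the right side, leaving a proper separation of order below
`l`. -/
theorem IsProper.exists_adj [Finite V] {s : Separation G} (h : s.IsProper) {l : ℕ}
    (hG : IsKConnected G l) (hs : s.separator.ncard ≤ l) {x : V} (hx : x ∈ s.separator) :
    ∃ y, y ∉ s.left ∧ G.Adj x y := by
  by_contra! hno
  let t : Separation G :=
    { left := s.left
      right := s.right \ {x}
      mem_or_mem := fun z => by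
        rcases s.mem_or_mem z with hz | hz
        · exact Or.inl hz
        · by_cases hzx : z = x
          · exact Or.inl (hzx ▸ hx.1)
          · exact Or.inr ⟨hz, hzx⟩
      not_adj := fun z y hz hy hzy => by
        by_cases hzx : z = x
        · exact hno y hy (hzx ▸ hzy)
        · exact s.not_adj z y (fun h => hz ⟨h, hzx⟩) hy hzy }
  have ht : t.IsProper := ⟨h.1, h.2.imp fun y hy hy' => hy hy'.1⟩
  have h1 := ht.le_ncard_separator hG
  have h2 : t.separator ⊂ s.separator :=
    ⟨fun z hz => ⟨hz.1, hz.2.1⟩, fun hsub => (hsub hx).2.2 rfl⟩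
  have := Set.ncard_lt_ncard h2
  omega

theorem subset_left_or_subset_right (s : Separation G) {k : ℕ} (hs : s.separator.ncard < k)
    {X : Set V} (hX : IsInseparable G k X) : X ⊆ s.left ∨ X ⊆ s.right := by
  by_contra! h
  obtain ⟨h1, h2⟩ := h
  obtain ⟨x, hx, hxl⟩ := Set.not_subset.1 h1
  obtain ⟨y, hy, hyr⟩ := Set.not_subset.1 h2
  exact hxl <| s.mem_left_of_reachable (fun h => hyr h.2) (fun h => hxl h.1)
    ((s.mem_or_mem y).resolve_right hyr) (hX y hy x hx _ hs _ _)

/-- The separation of `G` with separator `S` whose right side adds the component of `x`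
in `G - S`. -/
def ofComponent (G : SimpleGraph V) (S : Set V) (x : V) (hx : x ∈ Sᶜ) : Separation G where
  left := {v | ∀ hv : v ∈ Sᶜ, ¬ (G.induce Sᶜ).Reachable ⟨x, hx⟩ ⟨v, hv⟩}
  right := {v | ∀ hv : v ∈ Sᶜ, (G.induce Sᶜ).Reachable ⟨x, hx⟩ ⟨v, hv⟩}
  mem_or_mem v := by
    by_cases hv : v ∈ Sᶜ
    · by_cases h : (G.induce Sᶜ).Reachable ⟨x, hx⟩ ⟨v, hv⟩
      · exact Or.inr fun _ => h
      · exact Or.inl fun _ => h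
    · exact Or.inl fun h => absurd h hv
  not_adj u v hu hv h := by
    simp only [Set.mem_ofPred_eq, not_forall, not_not] at hu hv
    obtain ⟨hu, hu'⟩ := hu
    obtain ⟨hv, hv'⟩ := hv
    have huv : (G.induce Sᶜ).Adj ⟨v, hv⟩ ⟨u, hu⟩ := h.symm
    exact hu' (hv'.trans huv.reachable)

theorem separator_ofComponent (S : Set V) (x : V) (hx : x ∈ Sᶜ) :
    (ofComponent G S x hx).separator = S := by
  ext v
  constructor
  · rintro ⟨h1, h2⟩
    by_contra hv
    exact h1 hv (h2 hv)
  · exact fun hv => ⟨fun h => absurd hv h, fun h => absurd hv h⟩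

instance : MulAction (G ≃g G) (Separation G) where
  smul σ s :=
    { left := {x | σ⁻¹ x ∈ s.left}
      right := {x | σ⁻¹ x ∈ s.right}
      mem_or_mem := fun x => s.mem_or_mem _
      not_adj := fun x y hx hy h => s.not_adj _ _ hx hy ((σ⁻¹).map_rel_iff.2 h) }
  one_smul _ := rfl
  mul_smul σ τ s := by
    have h : ∀ x, (σ * τ)⁻¹ x = τ⁻¹ (σ⁻¹ x) := fun x => by rw [mul_inv_rev]; rfl
    refine Separation.ext ?_ ?_ <;> ext x
    · exact iff_of_eq (congrArg (· ∈ s.left) (h x))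
    · exact iff_of_eq (congrArg (· ∈ s.right) (h x))

theorem mem_smul_left {σ : G ≃g G} {s : Separation G} {x : V} :
    x ∈ (σ • s).left ↔ σ⁻¹ x ∈ s.left := Iff.rfl

theorem mem_smul_right {σ : G ≃g G} {s : Separation G} {x : V} :
    x ∈ (σ • s).right ↔ σ⁻¹ x ∈ s.right := Iff.rfl

theorem smul_inv (σ : G ≃g G) (s : Separation G) : σ • s⁻¹ = (σ • s)⁻¹ := rfl

theorem smul_le_smul (σ : G ≃g G) {s t : Separation G} (h : s ≤ t) : σ • s ≤ σ • t :=
  ⟨fun _ hx => h.1 hx, fun _ hx => h.2 hx⟩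

theorem separator_smul (σ : G ≃g G) (s : Separation G) :
    (σ • s).separator = σ '' s.separator := by
  ext x
  constructor
  · exact fun h => ⟨σ⁻¹ x, h, RelIso.apply_inv_self σ x⟩
  · rintro ⟨y, hy, rfl⟩
    change σ⁻¹ (σ y) ∈ s.left ∧ σ⁻¹ (σ y) ∈ s.right
    rwa [RelIso.inv_apply_self]

end Separation

/-! ### From a nested system of separations to a canonical tree-decomposition. -/

section Tree

variable {V : Type u} {G : SimpleGraph V}

open Separation

/-- A set of pairwise nested separations, closed under inversion, none of which has its left side
contained in its right side. -/
structure IsNestedSystem (N : Set (Separation G)) : Prop where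
  inv_mem : ∀ s ∈ N, s⁻¹ ∈ N
  not_inv_le : ∀ s ∈ N, ¬ s⁻¹ ≤ s
  nested : ∀ s ∈ N, ∀ t ∈ N, s ≤ t ∨ s ≤ t⁻¹ ∨ s⁻¹ ≤ t ∨ s⁻¹ ≤ t⁻¹

/-- A consistent orientation of `N`, each chosen separation being thought of as pointing towards
its right side. -/
structure IsOrientation (N O : Set (Separation G)) : Prop where
  subset : O ⊆ N
  total : ∀ s ∈ N, s ∈ O ∨ s⁻¹ ∈ O
  consistent : ∀ s ∈ O, ∀ t ∈ O, ¬ s⁻¹ ≤ t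

/-- The consistent orientations of `N`. -/
def Orientation (N : Set (Separation G)) : Type u := {O : Set (Separation G) // IsOrientation N O}

namespace Orientation

variable {N : Set (Separation G)}

instance [Finite V] : Finite (Orientation N) :=
  inferInstanceAs (Finite {O : Set (Separation G) // IsOrientation N O})

theorem inv_notMem (O : Orientation N) {s : Separation G} (hs : s ∈ O.1) : s⁻¹ ∉ O.1 :=
  fun h => O.2.consistent _ hs _ h le_rfl

theorem inv_mem (O : Orientation N) {s : Separation G} (hN : s ∈ N) (hs : s ∉ O.1) :
    s⁻¹ ∈ O.1 :=
  (O.2.total s hN).resolve_left hs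

/-- The orientation `P` arises from `O` by reversing `s`. -/
structure IsFlip (O P : Orientation N) (s : Separation G) : Prop where
  mem : s ∈ O.1
  inv_mem : s⁻¹ ∈ P.1
  mem_iff : ∀ t, t ≠ s → t ≠ s⁻¹ → (t ∈ O.1 ↔ t ∈ P.1)

theorem IsFlip.symm {O P : Orientation N} {s : Separation G} (h : IsFlip O P s) :
    IsFlip P O s⁻¹ :=
  ⟨h.inv_mem, h.mem, fun t h1 h2 => (h.mem_iff t h2 h1).symm⟩

/-- The graph on the consistent orientations of `N` whose edges are the reversals of one
separation. -/
def tree (N : Set (Separation G)) : SimpleGraph (Orientation N) where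
  Adj O P := ∃ s, IsFlip O P s
  symm := ⟨fun _ _ ⟨s, h⟩ => ⟨s⁻¹, h.symm⟩⟩
  loopless := ⟨fun O ⟨_, h⟩ => O.inv_notMem h.mem h.inv_mem⟩

theorem isFlip_of_adj {O P : Orientation N} (h : (tree N).Adj O P) {s : Separation G}
    (hO : s ∈ O.1) (hP : s ∉ P.1) : IsFlip O P s := by
  obtain ⟨t, ht⟩ := h
  by_cases h1 : s = t
  · exact h1 ▸ ht
  by_cases h2 : s = t⁻¹
  · exact absurd (h2 ▸ hO) (O.inv_notMem ht.mem)
  · exact absurd ((ht.mem_iff s h1 h2).1 hO) hP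

/-- Every `t` in `N` is nested with `s`; consistency of `O` with `s` and of `P` with `s⁻¹` then
decides how `t` is oriented. Hence each separation labels at most one edge. -/
theorem IsFlip.eq_setOf (hN : IsNestedSystem N) {O P : Orientation N} {s : Separation G}
    (h : IsFlip O P s) : O.1 = {t | t ∈ N ∧ (t ≤ s ∨ t < s⁻¹)} := by
  have hs := O.2.subset h.mem
  ext t
  constructor
  · intro ht
    refine ⟨O.2.subset ht, ?_⟩
    have hne : t ≠ s⁻¹ := by
      rintro rfl
      exact O.inv_notMem h.mem ht
    rcases hN.nested t (O.2.subset ht) s hs with h1 | h1 | h1 | h1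
    · exact Or.inl h1
    · exact Or.inr (lt_of_le_of_ne h1 hne)
    · exact absurd h1 (O.2.consistent _ ht _ h.mem)
    · by_cases hts : t = s
      · exact Or.inl hts.le
      · exact absurd (inv_le_inv h1)
          (P.2.consistent _ h.inv_mem _ ((h.mem_iff t hts hne).1 ht))
  · rintro ⟨ht, h1 | h1⟩
    · by_contra hO
      exact O.2.consistent _ (O.inv_mem ht hO) _ h.mem h1
    · by_contra hO
      have hO' := O.inv_mem ht hO
      have hP : t⁻¹ ∈ P.1 := by
        refine (h.mem_iff _ ?_ ?_).1 hO'
        · rintro rfl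
          exact h1.ne (inv_inv t).symm
        · intro he
          exact O.inv_notMem h.mem (he ▸ hO')
      exact P.2.consistent _ hP _ h.inv_mem h1.le

theorem IsFlip.unique (hN : IsNestedSystem N) {O P O' P' : Orientation N} {s : Separation G}
    (h : IsFlip O P s) (h' : IsFlip O' P' s) : O = O' ∧ P = P' :=
  ⟨Subtype.ext ((h.eq_setOf hN).trans (h'.eq_setOf hN).symm),
    Subtype.ext ((h.symm.eq_setOf hN).trans (h'.symm.eq_setOf hN).symm)⟩

/-- A walk between orientations that disagree on `s` reverses `s` at some point. -/
theorem exists_isFlip_mem_edges {O P : Orientation N} (p : (tree N).Walk O P) {s : Separation G}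
    (hO : s ∈ O.1) (hP : s ∉ P.1) : ∃ O' P', IsFlip O' P' s ∧ s(O', P') ∈ p.edges := by
  obtain ⟨d, hd, h1, h2⟩ := p.exists_boundary_dart {Q | s ∈ Q.1} hO hP
  exact ⟨d.fst, d.snd, isFlip_of_adj d.adj h1 h2, List.mem_map_of_mem hd⟩

/-- Every edge is a bridge: a walk between its ends must reverse its separation, and only this edge
does so. -/
theorem isAcyclic_tree (hN : IsNestedSystem N) : (tree N).IsAcyclic := by
  rw [isAcyclic_iff_forall_adj_isBridge]
  intro O P h
  rw [isBridge_iff_forall_walk_mem_edges]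
  intro p
  obtain ⟨s, hs⟩ := h
  obtain ⟨O', P', h', he⟩ := exists_isFlip_mem_edges p hs.mem
    fun h => P.inv_notMem h hs.inv_mem
  obtain ⟨rfl, rfl⟩ := hs.unique hN h'
  exact he

/-- Reversing a separation that is maximal among those on which `O` and `P` disagree. -/
theorem exists_isFlip_of_ne (hN : IsNestedSystem N) [Finite V] {O P : Orientation N}
    (h : (O.1 \ P.1).Nonempty) : ∃ O' s, IsFlip O O' s ∧ s ∉ P.1 := by
  obtain ⟨s, hs⟩ := (Set.toFinite (O.1 \ P.1)).exists_maximal h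
  have hsN := O.2.subset hs.1.1
  -- Maximality in `O \ P` extends to `O`: a larger `t` in `P` would be inconsistent with `s⁻¹` in
  -- `P`. This keeps the reversed orientation consistent.
  have hmax : ∀ t ∈ O.1, s ≤ t → t = s := by
    intro t ht hst
    by_contra hne
    have htP : t ∈ P.1 := by
      by_contra htP
      exact hne (le_antisymm (hs.2 ⟨ht, htP⟩ hst) hst)
    exact P.2.consistent _ (P.inv_mem hsN hs.1.2) _ htP hst
  have hinv : ∀ t, t⁻¹ = s ↔ t = s⁻¹ := fun t => inv_eq_iff_eq_inv
  have hor : IsOrientation N {t | t = s⁻¹ ∨ (t ∈ O.1 ∧ t ≠ s)} := by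
    refine ⟨?_, ?_, ?_⟩
    · rintro t (rfl | ht)
      · exact hN.inv_mem s hsN
      · exact O.2.subset ht.1
    · intro t ht
      by_cases h1 : t = s
      · exact Or.inr (Or.inl (h1 ▸ rfl))
      by_cases h2 : t = s⁻¹
      · exact Or.inl (Or.inl h2)
      rcases O.2.total t ht with h | h
      · exact Or.inl (Or.inr ⟨h, h1⟩)
      · exact Or.inr (Or.inr ⟨h, fun h' => h2 ((hinv t).1 h')⟩)
    · rintro t (rfl | ht) t' (rfl | ht') hle
      · exact hN.not_inv_le _ (hN.inv_mem s hsN) hle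
      · exact ht'.2 (hmax t' ht'.1 hle)
      · exact ht.2 (hmax t ht.1 (inv_le_inv hle))
      · exact O.2.consistent _ ht.1 _ ht'.1 hle
  refine ⟨⟨_, hor⟩, s, ⟨hs.1.1, Or.inl rfl, fun t h1 h2 => ?_⟩, hs.1.2⟩
  exact ⟨fun h => Or.inr ⟨h, h1⟩, fun h => (h.resolve_left h2).1⟩

theorem preconnected_tree (hN : IsNestedSystem N) [Finite V] : (tree N).Preconnected := by
  intro O P
  induction hn : (O.1 \ P.1).ncard using Nat.strong_induction_on generalizing O with
  | _ n ih =>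
    by_cases hne : (O.1 \ P.1).Nonempty
    · obtain ⟨O', s, h, hsP⟩ := exists_isFlip_of_ne hN hne
      have hadj : (tree N).Adj O O' := ⟨s, h⟩
      refine hadj.reachable.trans (ih _ ?_ O' rfl)
      rw [← hn]
      refine Set.ncard_lt_ncard ⟨fun t ht => ?_, fun hsub => ?_⟩
      · have h1 : t ≠ s := by
          rintro rfl
          exact O'.inv_notMem ht.1 h.inv_mem
        have h2 : t ≠ s⁻¹ := by
          rintro rfl
          exact ht.2 (P.inv_mem (O.2.subset h.mem) hsP)
        exact ⟨(h.mem_iff t h1 h2).2 ht.1, ht.2⟩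
      · exact O'.inv_notMem (hsub ⟨h.mem, hsP⟩).1 h.inv_mem
    · have hsub : O.1 ⊆ P.1 := Set.sdiff_eq_empty.1 (Set.not_nonempty_iff_eq_empty.1 hne)
      have : O = P := by
        refine Subtype.ext (hsub.antisymm fun t ht => ?_)
        by_contra htO
        exact P.inv_notMem ht (hsub (O.inv_mem (P.2.subset ht) htO))
      rw [this]

/-- The vertices to which all separations in `O` point. -/
def part (O : Orientation N) : Set V := {x | ∀ s ∈ O.1, x ∈ s.right}

/-- A set that is split by no separation in `N` lies in a part. -/
theorem exists_subset_part (hN : IsNestedSystem N) [Finite V] {X : Set V}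
    (hX : ∀ s ∈ N, X ⊆ s.left ∨ X ⊆ s.right) : ∃ O : Orientation N, X ⊆ O.part := by
  let F : Set (Set (Separation G)) :=
    {O | O ⊆ N ∧ (∀ s ∈ O, ∀ t ∈ O, ¬ s⁻¹ ≤ t) ∧ ∀ s ∈ O, X ⊆ s.right}
  obtain ⟨O, hO⟩ := (Set.toFinite F).exists_maximal
    ⟨∅, Set.empty_subset _, fun _ h => h.elim, fun _ h => h.elim⟩
  have hadd : ∀ s ∈ N, X ⊆ s.right → (∀ t ∈ O, ¬ s⁻¹ ≤ t) → s ∈ O := by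
    intro s hs hXs hcons
    have hmem : insert s O ∈ F := by
      refine ⟨Set.insert_subset hs hO.1.1, ?_, ?_⟩
      · rintro t (rfl | ht) t' (rfl | ht') hle
        · exact hN.not_inv_le _ hs hle
        · exact hcons t' ht' hle
        · exact hcons t ht (inv_le_comm hle)
        · exact hO.1.2.1 t ht t' ht' hle
      · rintro t (rfl | ht)
        · exact hXs
        · exact hO.1.2.2 t ht
    exact hO.2 hmem (Set.subset_insert s O) (Set.mem_insert s O)
  -- If some `t` in `O` blocks `s`, then `X` lies on both sides of `s`, so `s⁻¹` is also a
  -- candidate; a `t'` blocking that one would be inconsistent with `t`.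
  have htotal : ∀ s ∈ N, X ⊆ s.right → s ∈ O ∨ s⁻¹ ∈ O := by
    intro s hs hXs
    by_contra! h
    obtain ⟨t, ht, hst⟩ : ∃ t ∈ O, s⁻¹ ≤ t := by
      by_contra! h'
      exact h.1 (hadd s hs hXs h')
    obtain ⟨t', ht', hst'⟩ : ∃ t' ∈ O, s ≤ t' := by
      by_contra! h'
      exact h.2 (hadd _ (hN.inv_mem s hs) ((hO.1.2.2 t ht).trans hst.2) h')
    exact hO.1.2.1 t ht t' ht' ((inv_le_comm hst).trans hst')
  refine ⟨⟨O, hO.1.1, fun s hs => ?_, hO.1.2.1⟩, fun x hx s hs => hO.1.2.2 s hs hx⟩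
  rcases hX s hs with h | h
  · exact (htotal s⁻¹ (hN.inv_mem s hs) h).symm
  · exact htotal s hs h

/-- The tree-decomposition of `G` induced by a nested system of separations. -/
def treeDecomposition (hN : IsNestedSystem N) [Finite V] :
    TreeDecomposition G (Orientation N) where
  tree := tree N
  isTree :=
    { preconnected := preconnected_tree hN
      nonempty := (exists_subset_part hN (X := ∅) fun _ _ => Or.inl (Set.empty_subset _)).nonempty
      isAcyclic := isAcyclic_tree hN }
  part := part
  exists_mem_part x := by
    obtain ⟨O, hO⟩ := exists_subset_part hN (X := {x}) fun s _ => by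
      simpa only [Set.singleton_subset_iff] using s.mem_or_mem x
    exact ⟨O, hO rfl⟩
  exists_adj_mem_part x y h := by
    obtain ⟨O, hO⟩ := exists_subset_part hN (X := {x, y}) fun s _ => by
      simp only [Set.insert_subset_iff, Set.singleton_subset_iff]
      have h1 := s.mem_or_mem x
      have h2 := s.mem_or_mem y
      have h3 := s.not_adj x y
      have h4 := s.not_adj y x
      have h5 := h.symm
      tauto
    exact ⟨O, hO (Or.inl rfl), hO (Or.inr rfl)⟩
  inter_subset r t p q hq x hx := by
    classical
    by_contra hxq
    -- Neither `r` nor `t` contains this `s`, so both halves of the path use the unique edge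
    -- reversing it.
    obtain ⟨s, hs, hxs⟩ : ∃ s ∈ q.1, x ∉ s.right := by
      simpa only [part, Set.mem_ofPred_eq, not_forall, exists_prop] using hxq
    have hnodup := p.2.isTrail.edges_nodup
    rw [← p.1.take_spec hq, Walk.edges_append] at hnodup
    obtain ⟨O, P, h, he⟩ := exists_isFlip_mem_edges (p.1.takeUntil q hq).reverse hs
      fun h => hxs (hx.1 s h)
    obtain ⟨O', P', h', he'⟩ := exists_isFlip_mem_edges (p.1.dropUntil q hq) hs
      fun h => hxs (hx.2 s h)
    obtain ⟨rfl, rfl⟩ := h.unique hN h'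
    rw [Walk.edges_reverse, List.mem_reverse] at he
    exact (List.nodup_append'.1 hnodup).2.2 he he'

theorem adhesionLT_treeDecomposition (hN : IsNestedSystem N) [Finite V] {k : ℕ}
    (hk : ∀ s ∈ N, s.separator.ncard < k) : (treeDecomposition hN).AdhesionLT k := by
  rintro O P ⟨s, h⟩
  refine lt_of_le_of_lt (Set.ncard_le_ncard ?_) (hk s (O.2.subset h.mem))
  exact fun x hx => ⟨hx.2 _ h.inv_mem, hx.1 _ h.mem⟩

open scoped Pointwise

theorem isCanonical_treeDecomposition (hN : IsNestedSystem N) [Finite V]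
    (hinv : ∀ (σ : G ≃g G), ∀ s ∈ N, σ • s ∈ N) : (treeDecomposition hN).IsCanonical := by
  have hor : ∀ (σ : G ≃g G) (O : Orientation N), IsOrientation N (σ • O.1) := by
    intro σ O
    refine ⟨?_, ?_, ?_⟩
    · rintro _ ⟨s, hs, rfl⟩
      exact hinv σ s (O.2.subset hs)
    · intro s hs
      rw [Set.mem_smul_set_iff_inv_smul_mem, Set.mem_smul_set_iff_inv_smul_mem, smul_inv]
      exact O.2.total _ (hinv _ s hs)
    · intro s hs t ht hle
      rw [Set.mem_smul_set_iff_inv_smul_mem] at hs ht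
      exact O.2.consistent _ hs _ ht (smul_le_smul σ⁻¹ hle)
  let act : MulAction (G ≃g G) (Orientation N) :=
    { smul := fun σ O => ⟨σ • O.1, hor σ O⟩
      one_smul := fun O => Subtype.ext (one_smul _ O.1)
      mul_smul := fun σ τ O => Subtype.ext (mul_smul σ τ O.1) }
  have mem_smul : ∀ (σ : G ≃g G) (O : Orientation N) (s : Separation G),
      s ∈ (σ • O).1 ↔ σ⁻¹ • s ∈ O.1 :=
    fun σ O s => Set.mem_smul_set_iff_inv_smul_mem
  have hflip : ∀ (σ : G ≃g G) (O P : Orientation N) (s : Separation G), IsFlip O P s →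
      IsFlip (σ • O) (σ • P) (σ • s) := by
    intro σ O P s h
    refine ⟨?_, ?_, fun t h1 h2 => ?_⟩
    · rw [mem_smul, inv_smul_smul]
      exact h.mem
    · rw [mem_smul, ← smul_inv, inv_smul_smul]
      exact h.inv_mem
    · rw [mem_smul, mem_smul]
      refine h.mem_iff _ (fun he => h1 ?_) fun he => h2 ?_
      · rw [← he, smul_inv_smul]
      · rw [← smul_inv, ← he, smul_inv_smul]
  let φ : (G ≃g G) →* (tree N ≃g tree N) :=
    { toFun := fun σ =>
        { toEquiv := @MulAction.toPerm _ _ _ act σ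
          map_rel_iff' := by
            intro O P
            constructor
            · rintro ⟨s, h⟩
              have := hflip σ⁻¹ (σ • O) (σ • P) s h
              exact ⟨_, by simpa only [MulAction.toPerm_apply, inv_smul_smul] using this⟩
            · rintro ⟨s, h⟩
              exact ⟨σ • s, hflip σ O P s h⟩ }
      map_one' := by
        ext O : 1
        exact one_smul (G ≃g G) O
      map_mul' := fun σ τ => by
        ext O : 1
        exact mul_smul σ τ O }
  refine ⟨φ, fun σ O => ?_⟩
  have hpart : ∀ (σ : G ≃g G) (O : Orientation N) (x : V),
      x ∈ O.part → σ x ∈ (σ • O).part := by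
    intro σ O x hx s hs
    have := hx _ ((mem_smul σ O s).1 hs)
    rw [mem_smul_right, inv_inv] at this
    exact this
  ext x
  constructor
  · intro hx
    refine ⟨σ⁻¹ x, ?_, RelIso.apply_inv_self σ x⟩
    have := hpart σ⁻¹ (σ • O) x hx
    rwa [inv_smul_smul] at this
  · rintro ⟨y, hy, rfl⟩
    exact hpart σ O y hy

end Orientation

end Tree

/-! ### Nestedness of the minimal block separations. -/

section Blocks

variable {V : Type u} {G : SimpleGraph V} {k : ℕ}

open Separation

/-- A path with at least one inner vertex, from `x` outside `t.left` to `y` outside `s.left`, has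
an inner vertex in `s.right ∩ t.right` or in the part of the separator of `t` outside `s.right`. -/
theorem exists_mem_support_of_isPath (s t : Separation G) {x y : V}
    (hxt : x ∉ t.left) (hys : y ∉ s.left) (hyt : y ∈ t.left)
    {p : G.Walk x y} (hp : p.IsPath) (hlen : p.length ≠ 1) :
    ∃ w ∈ p.support, w ≠ x ∧ w ≠ y ∧
      (w ∈ s.right ∩ t.right ∨ w ∈ t.separator \ s.right) := by
  by_contra! hno
  cases p with
  | nil => exact hxt hyt
  | @cons _ u _ h q =>
    rw [Walk.cons_isPath_iff] at hp
    -- A path avoiding the described vertices stays outside `s.right` and `t.left` after `x`, and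
    -- from there no edge leads to `y`.
    have hstep : ∀ z ∈ q.support, z ≠ y → z ∈ t.right → z ∉ s.right ∧ z ∉ t.left := by
      intro z hz hzy hzt
      have hzx : z ≠ x := by
        rintro rfl
        exact hp.2 hz
      have := hno z (by simp [hz]) hzx hzy
      have hs : z ∉ s.right := fun h => this.1 ⟨h, hzt⟩
      exact ⟨hs, fun h => this.2 ⟨⟨h, hzt⟩, hs⟩⟩
    have huy : u ≠ y := by
      rintro rfl
      exact hlen (by rw [Walk.length_cons, Walk.length_eq_zero_iff.2 (Walk.isPath_iff_nil.1 hp.1)])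
    have hu := hstep u q.start_mem_support huy (t.mem_right_of_adj hxt h)
    obtain ⟨d, hd, h1, h2⟩ := q.exists_boundary_dart {z | z ∉ s.right ∧ z ∉ t.left} hu
      fun h => h.2 hyt
    refine h2 (hstep d.snd (q.dart_snd_mem_support_of_mem_darts hd) ?_
      (t.mem_right_of_adj h1.2 d.adj))
    intro hy
    exact s.not_adj d.fst d.snd h1.1 (hy ▸ hys) d.adj

theorem card_le_of_independentPaths [Finite V] {x y : V} {W : Finset (G.Path x y)}
    (hW : IndependentPaths (W : Set (G.Path x y))) {U : Set V}
    (hU : ∀ p ∈ W, ∃ w ∈ p.1.support, w ≠ x ∧ w ≠ y ∧ w ∈ U) : W.card ≤ U.ncard := by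
  have : Nonempty V := ⟨x⟩
  choose! f hf using hU
  rw [← Set.ncard_coe_finset]
  refine Set.ncard_le_ncard_of_injOn f (fun p hp => (hf p hp).2.2.2) fun p hp q hq hpq => ?_
  by_contra hne
  rcases hW hp hq hne (f p) (hf p hp).1 (hpq ▸ (hf q hq).1) with h | h
  · exact (hf p hp).2.1 h
  · exact (hf p hp).2.2.1 h

/-- The local condition on a pair of vertices `x`, `y`: many common neighbours, many independent
paths, or a common `k`-block. -/
def IsLinkedPair (G : SimpleGraph V) (k : ℕ) (x y : V) : Prop :=
  ((k : ℤ) - 3 ≤ ((G.commonNeighbors x y).ncard : ℤ)) ∨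
  (∃ W : Finset (G.Path x y), IndependentPaths (W : Set (G.Path x y)) ∧
    (∀ p ∈ W, p.1.length ≠ 1) ∧
    ⌊(3 / 2 : ℚ) * ((k : ℚ) - 2)⌋ ≤ (W.card : ℤ)) ∨
  (∃ X : Set V, IsKBlock G k X ∧ x ∈ X ∧ y ∈ X)

/-- Common neighbours of `x` and `y` lie in `s.right ∩ t.right` minus the pair, which has at most
k-4 elements. A common block would lie in `s.right ∩ t.right`, which is too small. For independent
paths, two bounds on their number are added. -/
theorem not_isLinkedPair [Finite V] {s t : Separation G} (hs : s.separator.ncard < k)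
    (ht : t.separator.ncard < k) (hsub : s.right ∩ t.right ⊆ s.left ∪ t.left)
    (hcard : (s.right ∩ t.right).ncard < k - 1) {x y : V}
    (hx : x ∈ s.separator) (hxt : x ∉ t.left) (hy : y ∈ t.separator) (hys : y ∉ s.left) :
    ¬ IsLinkedPair G k x y := by
  have hxr := (t.mem_or_mem x).resolve_left hxt
  have hyr := (s.mem_or_mem y).resolve_left hys
  have hxy : x ≠ y := by
    rintro rfl
    exact hxt hy.1
  have hpair : ((s.right ∩ t.right) \ {x, y}).ncard + 2 = (s.right ∩ t.right).ncard := by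
    rw [← Set.ncard_pair hxy]
    refine Set.ncard_sdiff_add_ncard_of_subset ?_
    rintro z (rfl | rfl)
    · exact ⟨hx.2, hxr⟩
    · exact ⟨hyr, hy.2⟩
  rintro (h | ⟨W, hW, hlen, hWcard⟩ | ⟨X, hX, hxX, hyX⟩)
  · have : G.commonNeighbors x y ⊆ (s.right ∩ t.right) \ {x, y} := by
      rintro z ⟨hxz, hyz⟩
      refine ⟨⟨s.mem_right_of_adj hys hyz, t.mem_right_of_adj hxt hxz⟩, ?_⟩
      rintro (rfl | rfl)
      · exact G.loopless.irrefl _ hxz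
      · exact G.loopless.irrefl _ hyz
    have := Set.ncard_le_ncard this
    omega
  · have h1 : W.card ≤ ((s.right ∩ t.right) \ {x, y} ∪ t.separator \ s.right).ncard := by
      refine card_le_of_independentPaths hW fun p hp => ?_
      obtain ⟨w, hw, hwx, hwy, h⟩ :=
        exists_mem_support_of_isPath s t hxt hys hy.1 p.2 (hlen p hp)
      refine ⟨w, hw, hwx, hwy, h.imp_left fun h => ⟨h, ?_⟩⟩
      rintro (rfl | rfl)
      · exact hwx rfl
      · exact hwy rfl
    have h2 : W.card ≤ ((s.right ∩ t.right) \ {x, y} ∪ s.separator \ t.right).ncard := by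
      refine card_le_of_independentPaths hW fun p hp => ?_
      obtain ⟨w, hw, hwy, hwx, h⟩ :=
        exists_mem_support_of_isPath t s hys hxt hx.1 p.2.reverse
          (by rw [Walk.length_reverse]; exact hlen p hp)
      rw [Walk.support_reverse, List.mem_reverse] at hw
      rw [Set.inter_comm] at h
      refine ⟨w, hw, hwx, hwy, h.imp_left fun h => ⟨h, ?_⟩⟩
      rintro (rfl | rfl)
      · exact hwx rfl
      · exact hwy rfl
    have h3 := h1.trans (Set.ncard_union_le _ _)
    have h4 := h2.trans (Set.ncard_union_le _ _)
    have h5 := Set.ncard_inter_add_ncard_sdiff_eq_ncard t.separator s.right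
    have h6 := Set.ncard_inter_add_ncard_sdiff_eq_ncard s.separator t.right
    have h7 : (s.right ∩ t.right).ncard ≤
        (t.separator ∩ s.right).ncard + (s.separator ∩ t.right).ncard := by
      refine (Set.ncard_le_ncard ?_).trans (Set.ncard_union_le _ _)
      intro z hz
      rcases hsub hz with h | h
      · exact Or.inr ⟨⟨h, hz.1⟩, hz.2⟩
      · exact Or.inl ⟨⟨h, hz.2⟩, hz.1⟩
    -- Adding `h3` and `h4` and using `h5`, `h6`, `h7` gives 2|W| ≤ |s.right ∩ t.right| + 2k - 6 ≤
    -- 3k - 8, which this inequality contradicts.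
    have h8 : (3 : ℤ) * (k - 2) < 2 * W.card + 2 := by
      have h9 := Int.lt_floor_add_one ((3 / 2 : ℚ) * ((k : ℚ) - 2))
      have h10 : ((⌊(3 / 2 : ℚ) * ((k : ℚ) - 2)⌋ : ℤ) : ℚ) ≤ (W.card : ℚ) := by
        exact_mod_cast hWcard
      have h11 : (3 : ℚ) * (k - 2) < 2 * W.card + 2 := by linarith
      exact_mod_cast h11
    omega
  · have h1 : X ⊆ s.right :=
      (s.subset_left_or_subset_right hs hX.prop.2).resolve_left fun h => hys (h hyX)
    have h2 : X ⊆ t.right :=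
      (t.subset_left_or_subset_right ht hX.prop.2).resolve_left fun h => hxt (h hxX)
    have := hX.prop.1
    have := Set.ncard_le_ncard (Set.subset_inter h1 h2)
    omega

/-- If adjacent vertices are linked, two proper separations with a corner of order less than
`k - 1` are nested. -/
theorem inv_le_of_ncard_lt [Finite V] (hconn : IsKConnected G (k - 1))
    (hadj : ∀ x y : V, G.Adj x y → IsLinkedPair G k x y) {s t : Separation G}
    (hs : s.IsProper) (ht : t.IsProper) (hsk : s.separator.ncard < k)
    (htk : t.separator.ncard < k) (hcorner : (s⁻¹.inf t⁻¹).separator.ncard < k - 1) :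
    s⁻¹ ≤ t := by
  have hsub : s.right ∩ t.right ⊆ s.left ∪ t.left := by
    intro z hz
    by_contra hz'
    refine hcorner.not_ge (IsProper.le_ncard_separator ⟨?_, z, hz'⟩ hconn)
    obtain ⟨-, w, hw⟩ := hs
    exact ⟨w, fun h => hw h.1⟩
  have hcard : (s.right ∩ t.right).ncard < k - 1 :=
    lt_of_le_of_lt (Set.ncard_le_ncard fun z hz =>
      show z ∈ (s⁻¹.inf t⁻¹).separator from ⟨hz, hsub hz⟩) hcorner
  have hedge : ∀ x y, x ∈ s.separator → x ∉ t.left → y ∈ t.separator → y ∉ s.left →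
      ¬ G.Adj x y := fun x y h1 h2 h3 h4 h =>
    not_isLinkedPair hsk htk hsub hcard h1 h2 h3 h4 (hadj x y h)
  -- A vertex violating this lies in exactly one separator. Its neighbour strictly across that
  -- separation lies in the other separator, giving an edge excluded by `hedge`.
  have key : s.right ∩ t.right ⊆ s.left ∩ t.left := by
    intro z hz
    by_cases h1 : z ∈ t.left
    · refine ⟨?_, h1⟩
      by_contra h2
      obtain ⟨y, hy, hzy⟩ := ht.exists_adj hconn (by omega) ⟨h1, hz.2⟩
      have hyr := s.mem_right_of_adj h2 hzy
      have hyl := (hsub ⟨hyr, (t.mem_or_mem y).resolve_left hy⟩).resolve_right hy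
      exact hedge y z ⟨hyl, hyr⟩ hy ⟨h1, hz.2⟩ h2 hzy.symm
    · exfalso
      have h2 := (hsub hz).resolve_right h1
      obtain ⟨y, hy, hzy⟩ := hs.exists_adj hconn (by omega) ⟨h2, hz.1⟩
      have hyr := t.mem_right_of_adj h1 hzy
      have hyl := (hsub ⟨(s.mem_or_mem y).resolve_left hy, hyr⟩).resolve_left hy
      exact hedge z y ⟨h2, hz.1⟩ h1 ⟨hyl, hyr⟩ hy hzy
  refine ⟨fun z hz => ?_, fun z hz => ?_⟩
  · exact (t.mem_or_mem z).elim id fun h => (key ⟨hz, h⟩).2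
  · exact (s.mem_or_mem z).elim id fun h => (key ⟨h, hz⟩).1

/-- The separations of order less than `k` that have `X` on their left and a vertex strictly on
their right. -/
def IsBlockSeparation (k : ℕ) (X : Set V) (s : Separation G) : Prop :=
  s.separator.ncard < k ∧ X ⊆ s.left ∧ ∃ x, x ∉ s.left

theorem IsBlockSeparation.isProper [Finite V] {X : Set V} {s : Separation G}
    (h : IsBlockSeparation k X s) (hX : k ≤ X.ncard) : s.IsProper := by
  refine ⟨h.2.2, ?_⟩
  by_contra! hr
  have := Set.ncard_le_ncard (s := X) (t := s.separator) fun x hx => ⟨h.2.1 hx, hr x⟩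
  have := h.1
  omega

/-- Every vertex outside a `k`-block can be separated from it. -/
theorem IsKBlock.exists_isBlockSeparation [Finite V] {X : Set V} (hX : IsKBlock G k X) {x : V}
    (hx : x ∉ X) : ∃ s : Separation G, IsBlockSeparation k X s ∧ x ∉ s.left := by
  obtain ⟨y, hy, S, hS, hxS, hyS, hnr⟩ : ∃ y ∈ X, ∃ S : Set V, S.ncard < k ∧
      ∃ (hxS : x ∈ Sᶜ) (hyS : y ∈ Sᶜ), ¬ (G.induce Sᶜ).Reachable ⟨x, hxS⟩ ⟨y, hyS⟩ := by
    -- Otherwise adding `x` to `X` would contradict maximality.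
    by_contra! hno
    refine hx (hX.2 ⟨?_, ?_⟩ (Set.subset_insert x X) (Set.mem_insert x X))
    · exact hX.prop.1.trans (Set.ncard_le_ncard (Set.subset_insert x X))
    · rintro u (rfl | hu) v (rfl | hv) S hS huS hvS
      · exact Reachable.rfl
      · exact hno v hv S hS huS hvS
      · exact (hno u hu S hS hvS huS).symm
      · exact hX.prop.2 u hu v hv S hS huS hvS
  have hord : (ofComponent G S x hxS).separator.ncard < k := by rwa [separator_ofComponent]
  have hxl : x ∉ (ofComponent G S x hxS).left := fun h => h hxS Reachable.rfl
  refine ⟨ofComponent G S x hxS, ⟨hord, ?_, x, hxl⟩, hxl⟩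
  exact (subset_left_or_subset_right _ hord hX.prop.2).resolve_right fun h => hnr (h hy hyS)

/-- The separations that are minimal for some `k`-block, and their inverses. -/
def blockSystem (G : SimpleGraph V) (k : ℕ) : Set (Separation G) :=
  {s | ∃ X, IsKBlock G k X ∧
    (Minimal (IsBlockSeparation k X) s ∨ Minimal (IsBlockSeparation k X) s⁻¹)}

theorem nested_of_minimal [Finite V] (hconn : IsKConnected G (k - 1))
    (hadj : ∀ x y : V, G.Adj x y → IsLinkedPair G k x y) {X : Set V} (hX : IsKBlock G k X)
    {s t : Separation G} (hs : Minimal (IsBlockSeparation k X) s)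
    (ht : t.IsProper) (htk : t.separator.ncard < k) :
    s ≤ t ∨ s ≤ t⁻¹ ∨ s⁻¹ ≤ t ∨ s⁻¹ ≤ t⁻¹ := by
  have key : ∀ t : Separation G, t.IsProper → t.separator.ncard < k → X ⊆ t.left →
      s ≤ t ∨ s⁻¹ ≤ t := by
    intro t ht htk hXt
    by_cases hc : (s⁻¹.inf t⁻¹).separator.ncard < k - 1
    · exact Or.inr (inv_le_of_ncard_lt hconn hadj (hs.prop.isProper hX.prop.1) ht hs.prop.1
        htk hc)
    -- The corner at `X` has order at most 2(k-1) - (k-1) = k-1, so it competes with `s`.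
    · have h1 := ncard_separator_inf_add s t
      have h2 := hs.prop.1
      refine Or.inl ((hs.2 ⟨?_, Set.subset_inter hs.prop.2.1 hXt, ?_⟩
        (s.inf_le_left t)).trans (s.inf_le_right t))
      · omega
      · exact hs.prop.2.2.imp fun x hx h => hx h.1
  rcases t.subset_left_or_subset_right htk hX.prop.2 with h | h
  · have := key t ht htk h
    tauto
  · have := key t⁻¹ ht.inv (by rwa [separator_inv]) h
    tauto

theorem isProper_of_mem_blockSystem [Finite V] {s : Separation G} (hs : s ∈ blockSystem G k) :
    s.IsProper := by
  obtain ⟨X, hX, h | h⟩ := hs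
  · exact h.prop.isProper hX.prop.1
  · exact (h.prop.isProper hX.prop.1).inv

theorem ncard_separator_lt_of_mem_blockSystem {s : Separation G} (hs : s ∈ blockSystem G k) :
    s.separator.ncard < k := by
  obtain ⟨X, hX, h | h⟩ := hs
  · exact h.prop.1
  · exact s.separator_inv ▸ h.prop.1

theorem isNestedSystem_blockSystem [Finite V] (hconn : IsKConnected G (k - 1))
    (hadj : ∀ x y : V, G.Adj x y → IsLinkedPair G k x y) :
    IsNestedSystem (blockSystem G k) where
  inv_mem := by
    rintro s ⟨X, hX, h⟩
    exact ⟨X, hX, h.symm⟩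
  not_inv_le s hs hle := by
    obtain ⟨⟨x, hx⟩, -⟩ := isProper_of_mem_blockSystem hs
    exact hx (hle.1 ((s.mem_or_mem x).resolve_left hx))
  nested s hs t ht := by
    have h1 := isProper_of_mem_blockSystem ht
    have h2 := ncard_separator_lt_of_mem_blockSystem ht
    obtain ⟨X, hX, h | h⟩ := hs
    · exact nested_of_minimal hconn hadj hX h h1 h2
    · have := nested_of_minimal hconn hadj hX h h1 h2
      rw [inv_inv] at this
      tauto

/-! ### Automorphism invariance, and parts that contain blocks. -/

theorem IsInseparable.image {X : Set V} (hX : IsInseparable G k X) (σ : G ≃g G) :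
    IsInseparable G k (σ '' X) := by
  rintro _ ⟨x, hx, rfl⟩ _ ⟨y, hy, rfl⟩ S hS hxS hyS
  have hcard : (σ ⁻¹' S).ncard < k := by
    rwa [Set.ncard_preimage_of_injective_subset_range σ.injective
      (by rw [σ.surjective.range_eq]; exact Set.subset_univ S)]
  let f : G.induce (σ ⁻¹' S)ᶜ →g G.induce Sᶜ :=
    { toFun := fun v => ⟨σ v.1, v.2⟩
      map_rel' := fun {_ _} h => σ.map_rel_iff.2 h }
  exact (hX x hx y hy _ hcard hxS hyS).map f

theorem image_inv_image (σ : G ≃g G) (X : Set V) : σ '' ((σ⁻¹ : G ≃g G) '' X) = X := by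
  rw [Set.image_image]
  simp only [RelIso.apply_inv_self, Set.image_id']

theorem IsKBlock.image {X : Set V} (hX : IsKBlock G k X) (σ : G ≃g G) :
    IsKBlock G k (σ '' X) := by
  refine ⟨⟨?_, hX.prop.2.image σ⟩, fun Y hY hle => ?_⟩
  · rw [Set.ncard_image_of_injective _ σ.injective]
    exact hX.prop.1
  · have h1 : X ⊆ (σ⁻¹ : G ≃g G) '' Y := by
      have := Set.image_mono (f := (σ⁻¹ : G ≃g G)) hle
      have h := image_inv_image σ⁻¹ X
      rw [inv_inv] at h
      rwa [h] at this
    have h2 := hX.2 ⟨by rw [Set.ncard_image_of_injective _ (σ⁻¹).injective]; exact hY.1,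
      hY.2.image σ⁻¹⟩ h1
    have := Set.image_mono (f := σ) h2
    rwa [image_inv_image] at this

theorem IsBlockSeparation.smul {X : Set V} {s : Separation G} (h : IsBlockSeparation k X s)
    (σ : G ≃g G) : IsBlockSeparation k (σ '' X) (σ • s) := by
  refine ⟨?_, ?_, ?_⟩
  · rw [separator_smul, Set.ncard_image_of_injective _ σ.injective]
    exact h.1
  · rintro _ ⟨x, hx, rfl⟩
    rw [mem_smul_left, RelIso.inv_apply_self]
    exact h.2.1 hx
  · obtain ⟨x, hx⟩ := h.2.2
    exact ⟨σ x, by rwa [mem_smul_left, RelIso.inv_apply_self]⟩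

theorem minimal_isBlockSeparation_smul {X : Set V} {s : Separation G}
    (h : Minimal (IsBlockSeparation k X) s) (σ : G ≃g G) :
    Minimal (IsBlockSeparation k (σ '' X)) (σ • s) := by
  refine ⟨h.prop.smul σ, fun t ht hle => ?_⟩
  have h1 := ht.smul σ⁻¹
  have h2 := image_inv_image σ⁻¹ X
  rw [inv_inv] at h2
  rw [h2] at h1
  have h3 := smul_le_smul σ⁻¹ hle
  rw [inv_smul_smul] at h3
  have h4 := smul_le_smul σ (h.2 h1 h3)
  rwa [smul_inv_smul] at h4

theorem smul_mem_blockSystem (σ : G ≃g G) {s : Separation G} (hs : s ∈ blockSystem G k) :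
    σ • s ∈ blockSystem G k := by
  obtain ⟨X, hX, h⟩ := hs
  refine ⟨σ '' X, hX.image σ, ?_⟩
  rw [← smul_inv]
  exact h.imp (minimal_isBlockSeparation_smul · σ) (minimal_isBlockSeparation_smul · σ)

/-- A part containing a `k`-block has no further vertices. -/
theorem IsKBlock.eq_part [Finite V] {X : Set V} (hX : IsKBlock G k X)
    {O : Orientation (blockSystem G k)} (hsub : X ⊆ O.part) : O.part = X := by
  refine Set.Subset.antisymm (fun x hx => ?_) hsub
  by_contra hxX
  obtain ⟨s, hs, hxs⟩ := hX.exists_isBlockSeparation hxX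
  obtain ⟨t, hts, ht⟩ := (Set.toFinite {s | IsBlockSeparation (G := G) k X s}).exists_le_minimal hs
  have htN : t ∈ blockSystem G k := ⟨X, hX, Or.inl ht⟩
  -- `O` must point towards `X`: if `t` were in `O`, `X` would lie in the separator of `t`, which
  -- has fewer than k vertices.
  rcases O.2.total t htN with h | h
  · obtain ⟨-, y, hy⟩ := ht.prop.isProper hX.prop.1
    have := Set.ncard_le_ncard (s := X) (t := t.separator)
      fun z hz => ⟨ht.prop.2.1 hz, hsub hz t h⟩
    have := hX.prop.1
    have := ht.prop.1
    omega
  · exact hxs (hts.1 (hx _ h))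

end Blocks

end CanonicalTD

theorem theorem3p4 {V : Type u} [Finite V] (G : SimpleGraph V) (k : ℕ) (hk : 1 ≤ k)
    (hconn : CanonicalTD.IsKConnected G (k - 1))
    (hadj : ∀ x y : V, G.Adj x y →
      ((k : ℤ) - 3 ≤ ((G.commonNeighbors x y).ncard : ℤ)) ∨
      (∃ W : Finset (G.Path x y), CanonicalTD.IndependentPaths (W : Set (G.Path x y)) ∧
        (∀ p ∈ W, p.1.length ≠ 1) ∧
        ⌊(3 / 2 : ℚ) * ((k : ℚ) - 2)⌋ ≤ (W.card : ℤ)) ∨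
      (∃ X : Set V, CanonicalTD.IsKBlock G k X ∧ x ∈ X ∧ y ∈ X)) :
    ∃ (ι : Type u) (_ : Finite ι) (D : CanonicalTD.TreeDecomposition G ι),
      D.IsCanonical ∧ D.AdhesionLT k ∧
      (∀ t : ι, (∃ X : Set V, CanonicalTD.IsKBlock G k X ∧ X ⊆ D.part t) →
        CanonicalTD.IsKBlock G k (D.part t)) ∧
      (∀ X : Set V, CanonicalTD.IsKBlock G k X → ∃ t : ι, X ⊆ D.part t) ∧
      (∀ X Y : Set V, CanonicalTD.IsKBlock G k X → CanonicalTD.IsKBlock G k Y → X ≠ Y →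
        ∀ s t : ι, X ⊆ D.part s → Y ⊆ D.part t → D.part s ≠ D.part t) := by
  have hN := CanonicalTD.isNestedSystem_blockSystem hconn hadj
  have hpart : ∀ (t : CanonicalTD.Orientation (CanonicalTD.blockSystem G k)) (X : Set V),
      CanonicalTD.IsKBlock G k X → X ⊆ t.part → t.part = X := fun t X hX h => hX.eq_part h
  refine ⟨_, inferInstance, CanonicalTD.Orientation.treeDecomposition hN,
    CanonicalTD.Orientation.isCanonical_treeDecomposition hN
      fun σ s => CanonicalTD.smul_mem_blockSystem σ,
    CanonicalTD.Orientation.adhesionLT_treeDecomposition hN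
      fun s => CanonicalTD.ncard_separator_lt_of_mem_blockSystem, ?_, ?_, ?_⟩
  · rintro t ⟨X, hX, h⟩
    exact (congrArg (CanonicalTD.IsKBlock G k) (hpart t X hX h)).mpr hX
  · intro X hX
    exact CanonicalTD.Orientation.exists_subset_part hN fun s hs =>
      s.subset_left_or_subset_right (CanonicalTD.ncard_separator_lt_of_mem_blockSystem hs)
        hX.prop.2
  · intro X Y hX hY hne s t hs ht he
    exact hne ((hpart s X hX hs).symm.trans (he.trans (hpart t Y hY ht)))
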